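/- Let $\sigma(t)=1/(1+e^{-t})$, and let $p\ge 2$, $n\ge 1$. Let $(X,Y,S)$ be a random triple with $X\in\mathbb R^p$ (feature vector), $Y\in\{0,1\}$ (true class) and $S\in\{0,1\}$ (label indicator), such that $P(S=1\mid X,Y=0)=0$, and suppose that for some $\beta_*,\gamma_*\in\mathbb R^p$ with $|\beta_*|_1>|\gamma_*|_1$ $$P(Y=1\mid X=x)=\sigma(\beta_*^Tx),\qquad P(S=1\mid Y=1,X=x)=\sigma(\gamma_*^Tx).$$ Let $(X_i,Y_i,S_i)$, $i=1,\dots,n$, be i.i.d. copies of $(X,Y,S)$, and suppose that for some $\mu>0$ we have $\mathbb E\exp(tX_{ij})\le\exp(\mu^2t^2/2)$ for all $t\in\mathbb R$, $i=1,\dots,n$ and $j=1,\dots,p$. For $a,b\in\mathbb R$ and $s\in\{0,1\}$ let $$\phi(a,b,s)=-s\log[\sigma(a)\sigma(b)]-(1-s)\log[1-\sigma(a)\sigma(b)],$$ and for $\theta=(\beta,\gamma)\in\mathbb R^p\times\mathbb R^p$ let $$Q(\theta)=\mathbb E\,\phi(\beta^TX,\gamma^TX,S),\qquad Q_n(\theta)=\frac1n\sum_{i=1}^n\phi(\beta^TX_i,\gamma^TX_i,S_i),\qquad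 |\theta|_1=|\beta|_1+|\gamma|_1 .$$ Put $\theta_*=(\beta_*,\gamma_*)$, let $r>0$, and let $\hat\theta$ be any minimiser of $Q_n$ over $\{\theta:|\theta-\theta_*|_1\le r\}$. Then $Q(\theta)$ is finite for all $\theta$, and for every $s\in(0,1)$ $$P\left(Q(\hat\theta)-Q(\theta_*)\le\frac{32\mu r}{s}\sqrt{\frac{\log p}{n}}\right)\ge 1-s .$$ -/

import Mathlib

open MeasureTheory ProbabilityTheory

open scoped NNReal

namespace PULearning

noncomputable section

/-- One complete observation `(x, y, s)`: feature vector `x ∈ ℝ^p`, true class `y ∈ {0, 1}`,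
label indicator `s ∈ {0, 1}`. -/
abbrev Obs (p : ℕ) : Type := (Fin p → ℝ) × Fin 2 × Fin 2

/-- The feature vector `X`. -/
def Obs.x {p : ℕ} (z : Obs p) : Fin p → ℝ := z.1

/-- The true class `Y`. -/
def Obs.y {p : ℕ} (z : Obs p) : Fin 2 := z.2.1

/-- The label indicator `S`. -/
def Obs.s {p : ℕ} (z : Obs p) : Fin 2 := z.2.2

/-- The joint parameter `θ = (β, γ)`. -/
abbrev Param (p : ℕ) : Type := (Fin p → ℝ) × (Fin p → ℝ)

/-- The norm `|a|₁ = ∑ |a_j|` on `ℝ^p`. -/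
def l1Norm {p : ℕ} (a : Fin p → ℝ) : ℝ := ∑ j, |a j|

/-- The `ℓ₁` norm of the joint parameter, as a vector of `ℝ^(2p)`. -/
def Param.l1Norm {p : ℕ} (θ : Param p) : ℝ :=
  PULearning.l1Norm θ.1 + PULearning.l1Norm θ.2

/-- The closed `ℓ₁` ball of radius `r` around `θ₀`. -/
def l1Ball {p : ℕ} (θ₀ : Param p) (r : ℝ) : Set (Param p) :=
  {θ | Param.l1Norm (θ - θ₀) ≤ r}

/-- The double logistic model for the joint law `D` of `(X, Y, S)`, with ground truth `(β, γ)`. -/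
structure IsDoubleLogistic {p : ℕ} (D : Measure (Obs p)) (β γ : Fin p → ℝ) : Prop where
  /-- `P(Y = 1 | X) = σ(βᵀ X)` -/
  posterior :
    D⟦{z : Obs p | z.y = 1} | MeasurableSpace.comap (fun z : Obs p => z.x) inferInstance⟧
      =ᵐ[D] fun z => Real.sigmoid (β ⬝ᵥ z.x)
  /-- `P(S = 1 | X, Y = 1) = σ(γᵀ X)` -/
  propensity : ∀ᵐ z ∂D, z.y = 1 →
    (D⟦{z : Obs p | z.s = 1} |
        MeasurableSpace.comap (fun z : Obs p => (z.x, z.y)) inferInstance⟧) z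
      = Real.sigmoid (γ ⬝ᵥ z.x)
  /-- `P(S = 1 | X, Y = 0) = 0` -/
  negative_unlabeled : ∀ᵐ z ∂D, z.y = 0 →
    (D⟦{z : Obs p | z.s = 1} |
        MeasurableSpace.comap (fun z : Obs p => (z.x, z.y)) inferInstance⟧) z = 0
  /-- `|β|₁ > |γ|₁` -/
  l1Norm_lt : l1Norm γ < l1Norm β

/-- The logistic loss `φ(a, b, s)`. -/
def loss (a b : ℝ) (s : Fin 2) : ℝ :=
  -((s : ℕ) : ℝ) * Real.log (Real.sigmoid a * Real.sigmoid b)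
    - (1 - ((s : ℕ) : ℝ)) * Real.log (1 - Real.sigmoid a * Real.sigmoid b)

/-- The loss `φ(βᵀx, γᵀx, s)` of the parameter `θ = (β, γ)` at an observation. -/
def obsLoss {p : ℕ} (θ : Param p) (z : Obs p) : ℝ :=
  loss (θ.1 ⬝ᵥ z.x) (θ.2 ⬝ᵥ z.x) z.s

/-- The joint risk `Q(θ) = E φ(βᵀX, γᵀX, S)`. -/
def risk {p : ℕ} (D : Measure (Obs p)) (θ : Param p) : ℝ := ∫ z, obsLoss θ z ∂D

/-- The joint empirical risk `Q_n(θ)` of a sample `z₁, …, z_n`. -/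
def empRisk {p n : ℕ} (z : Fin n → Obs p) (θ : Param p) : ℝ :=
  (1 / (n : ℝ)) * ∑ i, obsLoss θ (z i)

/-- `θ` is a minimiser of the empirical risk over the `ℓ₁` ball of radius `r` around `θ₀`. -/
def IsBallMinimiser {p n : ℕ} (z : Fin n → Obs p) (θ₀ : Param p) (r : ℝ) (θ : Param p) : Prop :=
  θ ∈ l1Ball θ₀ r ∧ IsMinOn (empRisk z) (l1Ball θ₀ r) θ

/-- The excess risk `R(θ) = Q(θ) - Q(θ₀)`. -/
def excessRisk {p : ℕ} (D : Measure (Obs p)) (θ₀ θ : Param p) : ℝ := risk D θ - risk D θ₀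

end

end PULearning

namespace PULearning

/-! The loss is 1-Lipschitz in each of its two linear predictors (`abs_loss_sub_loss_le`). Since
`θ₀` lies in the ball, a minimiser satisfies `n * excessRisk ≤ centredProcess`
(`mul_excessRisk_le_centredProcess`), so it suffices to control the supremum of the centred process
over the ball.

Its mean is bounded by symmetrization (`integral_sup'_centered_le`, factor 2) and a contraction that
gives each predictor its own Rademacher sign (`sum_sup'_rademacher_le`, factor 2). What remains is
linear in `θ - θ₀`, so ℓ₁/ℓ∞ duality leaves `r` times a maximum of signed coordinate sums, which are
sub-Gaussian for every fixed sign pattern. Optimising the exponential parameter gives a mean of at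
most `10 μ r n √(log p / n)`, and Markov's inequality finishes with room to spare.

Averages over signs are written as unnormalised finite sums, whence the powers of 2. Suprema are
taken over finite sets first; a countable dense subset then reaches the whole ball. -/

/-! ### Lipschitz continuity of the loss -/

theorem log_sub_log_le_of_le_exp_mul {x y d : ℝ} (hx : 0 < x) (hy : 0 < y)
    (h : x ≤ Real.exp d * y) : Real.log x - Real.log y ≤ d := by
  have := Real.log_le_log hx h
  rw [Real.log_mul (Real.exp_pos d).ne' hy.ne', Real.log_exp] at this
  linarith

theorem sigmoid_le_exp_mul_sigmoid {a b : ℝ} (h : a ≤ b) :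
    Real.sigmoid b ≤ Real.exp (b - a) * Real.sigmoid a := by
  have hA := Real.exp_pos (-a)
  have hB := Real.exp_pos (-b)
  have h1 : Real.exp (b - a) * Real.exp (-b) = Real.exp (-a) := by
    rw [← Real.exp_add]; ring_nf
  have h2 : 1 ≤ Real.exp (b - a) := Real.one_le_exp (by linarith)
  rw [Real.sigmoid_def, Real.sigmoid_def, ← div_eq_mul_inv, inv_eq_one_div,
    div_le_div_iff₀ (by positivity) (by positivity)]
  nlinarith

theorem abs_log_sigmoid_sub_le (a b : ℝ) :
    |Real.log (Real.sigmoid a) - Real.log (Real.sigmoid b)| ≤ |a - b| := by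
  wlog h : a ≤ b generalizing a b
  · rw [abs_sub_comm, abs_sub_comm a b]
    exact this b a (le_of_not_ge h)
  have h1 := Real.log_le_log (Real.sigmoid_pos a) (Real.sigmoid_le h)
  have h2 := log_sub_log_le_of_le_exp_mul (Real.sigmoid_pos b) (Real.sigmoid_pos a)
    (sigmoid_le_exp_mul_sigmoid h)
  rw [abs_of_nonpos (by linarith), abs_of_nonpos (by linarith)]
  linarith

/-- The derivative in `a` is `-σ(1 - σ)v / (1 - σv)`, of modulus at most `σ ≤ 1` because `(1 - σ)v ≤
1 - σv`. The proof uses the equivalent multiplicative form `key`, which avoids calculus. -/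
theorem abs_log_one_sub_sigmoid_mul_sub_le (a b : ℝ) {v : ℝ} (hv0 : 0 ≤ v) (hv1 : v < 1) :
    |Real.log (1 - Real.sigmoid a * v) - Real.log (1 - Real.sigmoid b * v)| ≤ |a - b| := by
  wlog h : a ≤ b generalizing a b
  · rw [abs_sub_comm, abs_sub_comm a b]
    exact this b a (le_of_not_ge h)
  have hpos : ∀ c, 0 < 1 - Real.sigmoid c * v := fun c => by
    nlinarith [Real.sigmoid_pos c, Real.sigmoid_lt_one c]
  have hA := Real.exp_pos (-a)
  have hB := Real.exp_pos (-b)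
  have hBA : Real.exp (-b) ≤ Real.exp (-a) := Real.exp_le_exp.2 (by linarith)
  have hE : Real.exp (b - a) = Real.exp (-a) / Real.exp (-b) := by
    rw [← Real.exp_sub]; ring_nf
  have key : 1 - Real.sigmoid a * v ≤ Real.exp (b - a) * (1 - Real.sigmoid b * v) := by
    rw [hE, Real.sigmoid_def, Real.sigmoid_def]
    generalize Real.exp (-a) = A at *
    generalize Real.exp (-b) = B at *
    have e1 : 1 - (1 + A)⁻¹ * v = (A + (1 - v)) / (1 + A) := by field_simp; ring
    have e2 : A / B * (1 - (1 + B)⁻¹ * v) = A * (B + (1 - v)) / (B * (1 + B)) := by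
      field_simp; ring
    rw [e1, e2, div_le_div_iff₀ (by positivity) (by positivity)]
    have hw : 0 ≤ 1 - v := by linarith
    have h1 : A * B * B ≤ A * B * A := by gcongr
    have h2 : (1 - v) * (B * (1 + B)) ≤ (1 - v) * (A * (1 + A)) := by gcongr
    nlinarith
  have h1 := Real.log_le_log (hpos b) (show 1 - Real.sigmoid b * v ≤ 1 - Real.sigmoid a * v by
    nlinarith [Real.sigmoid_le h])
  have h2 := log_sub_log_le_of_le_exp_mul (hpos a) (hpos b) key
  rw [abs_of_nonneg (by linarith), abs_of_nonpos (by linarith)]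
  linarith

theorem loss_one (a b : ℝ) :
    loss a b 1 = -(Real.log (Real.sigmoid a) + Real.log (Real.sigmoid b)) := by
  simp [loss, Real.log_mul (Real.sigmoid_pos a).ne' (Real.sigmoid_pos b).ne']

theorem loss_zero (a b : ℝ) :
    loss a b 0 = -Real.log (1 - Real.sigmoid a * Real.sigmoid b) := by
  simp [loss]

/-- Change one argument at a time, freezing the other sigmoid as the factor `v`. -/
theorem abs_loss_sub_loss_le (a b a' b' : ℝ) (s : Fin 2) :
    |loss a b s - loss a' b' s| ≤ |a - a'| + |b - b'| := by
  obtain rfl | rfl : s = 0 ∨ s = 1 := by omega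
  · have h1 := abs_log_one_sub_sigmoid_mul_sub_le a a' (Real.sigmoid_nonneg b)
      (Real.sigmoid_lt_one b)
    have h2 := abs_log_one_sub_sigmoid_mul_sub_le b b' (Real.sigmoid_nonneg a')
      (Real.sigmoid_lt_one a')
    rw [mul_comm, mul_comm (Real.sigmoid b')] at h2
    rw [loss_zero, loss_zero]
    rw [abs_le] at *
    constructor <;> linarith
  · have h1 := abs_log_sigmoid_sub_le a a'
    have h2 := abs_log_sigmoid_sub_le b b'
    rw [loss_one, loss_one]
    rw [abs_le] at *
    constructor <;> linarith

/-! ### Contraction for Rademacher sums -/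

/-- The sign `±1` attached to a Boolean. -/
def boolSign (b : Bool) : ℝ := if b then 1 else -1

@[simp] theorem boolSign_true : boolSign true = 1 := rfl

@[simp] theorem boolSign_false : boolSign false = -1 := rfl

/-- Comparison of a single Rademacher sign multiplying a function which is Lipschitz in two
arguments with two independent signs multiplying the arguments. -/
theorem sum_sup'_boolSign_le {ι : Type*} {T : Finset ι} (hT : T.Nonempty) (f h a b : ι → ℝ)
    (hL : ∀ t t', |h t - h t'| ≤ |a t - a t'| + |b t - b t'|) :
    4 * ∑ ε : Bool, T.sup' hT (fun t => f t + boolSign ε * h t) ≤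
      2 * ∑ η : Bool × Bool,
        T.sup' hT (fun t => f t + 2 * (boolSign η.1 * a t + boolSign η.2 * b t)) := by
  -- With `t`, `u` the maximisers for the two signs, `h t - h u ≤ 2 max(|a t - a u|, |b t - b u|)`,
  -- which is where the factor 2 arises. On the right, test with `t` or `u` according to the sign
  -- attached to the larger difference; the terms with the other sign cancel.
  obtain ⟨t, ht, e1⟩ := T.exists_mem_eq_sup' hT (fun t => f t + boolSign true * h t)
  obtain ⟨u, hu, e2⟩ := T.exists_mem_eq_sup' hT (fun t => f t + boolSign false * h t)
  have le (η : Bool × Bool) (w : ι) (hw : w ∈ T) :=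
    T.le_sup' (fun t => f t + 2 * (boolSign η.1 * a t + boolSign η.2 * b t)) hw
  simp only [Fintype.sum_prod_type, Fintype.sum_bool, e1, e2]
  have h1 := le (true, true) t ht
  have h2 := le (true, true) u hu
  have h3 := le (true, false) t ht
  have h4 := le (true, false) u hu
  have h5 := le (false, true) t ht
  have h6 := le (false, true) u hu
  have h7 := le (false, false) t ht
  have h8 := le (false, false) u hu
  have h9 := (le_abs_self _).trans (hL t u)
  simp only [boolSign_true, boolSign_false] at *
  rcases abs_cases (a t - a u) with ⟨ha, -⟩ | ⟨ha, -⟩ <;>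
  rcases abs_cases (b t - b u) with ⟨hb, -⟩ | ⟨hb, -⟩ <;>
  rcases le_total (|a t - a u|) (|b t - b u|) with hab | hab <;>
  rw [ha, hb] at h9 hab <;> linarith

/-- Vector contraction for Rademacher averages of functions Lipschitz in two arguments. -/
theorem sum_sup'_rademacher_le {ι : Type*} {T : Finset ι} (hT : T.Nonempty) (n : ℕ)
    (f : ι → ℝ) (h a b : Fin n → ι → ℝ)
    (hL : ∀ i t t', |h i t - h i t'| ≤ |a i t - a i t'| + |b i t - b i t'|) :
    2 ^ n * ∑ ε : Fin n → Bool, T.sup' hT (fun t => f t + ∑ i, boolSign (ε i) * h i t) ≤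
      ∑ η : Fin n → Bool × Bool, T.sup' hT (fun t =>
        f t + ∑ i, 2 * (boolSign (η i).1 * a i t + boolSign (η i).2 * b i t)) := by
  -- The arbitrary offset `f` absorbs the coordinate already contracted.
  induction n generalizing f with
  | zero => simp
  | succ n ih =>
    rw [← (Fin.consEquiv (fun _ => Bool)).sum_comp,
      ← (Fin.consEquiv (fun _ => Bool × Bool)).sum_comp]
    simp only [Fintype.sum_prod_type_right, Fin.consEquiv_apply, Fin.sum_univ_succ, Fin.cons_zero,
      Fin.cons_succ]
    have step1 : ∀ ε : Fin n → Bool, 2 * ∑ x : Bool, T.sup' hT (fun t => f t +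
          (boolSign x * h 0 t + ∑ i, boolSign (ε i) * h i.succ t)) ≤
        ∑ x : Bool × Bool, T.sup' hT (fun t => (f t +
          2 * (boolSign x.1 * a 0 t + boolSign x.2 * b 0 t)) +
            ∑ i, boolSign (ε i) * h i.succ t) := by
      intro ε
      have := sum_sup'_boolSign_le hT (fun t => f t + ∑ i, boolSign (ε i) * h i.succ t)
        (h 0) (a 0) (b 0) (hL 0)
      have e1 : ∀ x : Bool, (fun t => f t +
          (boolSign x * h 0 t + ∑ i, boolSign (ε i) * h i.succ t)) =
          fun t => f t + ∑ i, boolSign (ε i) * h i.succ t + boolSign x * h 0 t := fun x => by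
        ext t; ring
      have e2 : ∀ x : Bool × Bool, (fun t => (f t +
          2 * (boolSign x.1 * a 0 t + boolSign x.2 * b 0 t)) +
            ∑ i, boolSign (ε i) * h i.succ t) = fun t => f t + ∑ i, boolSign (ε i) * h i.succ t +
          2 * (boolSign x.1 * a 0 t + boolSign x.2 * b 0 t) := fun x => by
        ext t; ring
      simp only [e1, e2]
      linarith
    have step2 : ∀ x : Bool × Bool, _ := fun x => ih (fun t => f t +
          2 * (boolSign x.1 * a 0 t + boolSign x.2 * b 0 t)) (fun i => h i.succ)
          (fun i => a i.succ) (fun i => b i.succ) (fun i => hL i.succ)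
    calc _ = 2 ^ n * ∑ ε : Fin n → Bool, 2 * ∑ x : Bool, T.sup' hT (fun t => f t +
          (boolSign x * h 0 t + ∑ i, boolSign (ε i) * h i.succ t)) := by
          rw [← Finset.mul_sum]; ring
      _ ≤ 2 ^ n * ∑ ε : Fin n → Bool, ∑ x : Bool × Bool, T.sup' hT (fun t => (f t +
          2 * (boolSign x.1 * a 0 t + boolSign x.2 * b 0 t)) +
            ∑ i, boolSign (ε i) * h i.succ t) := by
          gcongr with ε; exact step1 ε
      _ = ∑ x : Bool × Bool, 2 ^ n * ∑ ε : Fin n → Bool, T.sup' hT (fun t => (f t +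
          2 * (boolSign x.1 * a 0 t + boolSign x.2 * b 0 t)) +
            ∑ i, boolSign (ε i) * h i.succ t) := by
          rw [Finset.sum_comm, Finset.mul_sum]
      _ ≤ _ := Finset.sum_le_sum fun x _ => step2 x
      _ = _ := by
          rw [Finset.sum_comm]
          simp only [Fintype.sum_prod_type_right, add_assoc]

/-! ### Symmetrization -/

theorem integrable_finset_sup' {α ι : Type*} {m : MeasurableSpace α} {ν : Measure α}
    {T : Finset ι} (hT : T.Nonempty) {g : ι → α → ℝ} (hg : ∀ t ∈ T, Integrable (g t) ν) :
    Integrable (fun x => T.sup' hT (fun t => g t x)) ν := by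
  have : Integrable (T.sup' hT g) ν :=
    Finset.sup'_induction hT g (p := fun g => Integrable g ν) (fun _ h _ h' => h.sup h') hg
  convert this using 1
  ext x
  rw [Finset.sup'_apply]

/-- Exchanging the coordinates of two independent samples selected by `ε`. -/
theorem measurePreserving_swap_coordinates {α : Type*} [MeasurableSpace α] (D : Measure α)
    [IsProbabilityMeasure D] {n : ℕ} (ε : Fin n → Bool) :
    MeasurePreserving (fun w : (Fin n → α) × (Fin n → α) =>
        ((fun i => if ε i then w.1 i else w.2 i, fun i => if ε i then w.2 i else w.1 i) :
          (Fin n → α) × (Fin n → α)))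
      ((Measure.pi fun _ => D).prod (Measure.pi fun _ => D))
      ((Measure.pi fun _ => D).prod (Measure.pi fun _ => D)) := by
  have h1 := measurePreserving_arrowProdEquivProdArrow α α (Fin n) (fun _ => D) (fun _ => D)
  have h2 : MeasurePreserving (fun (w : Fin n → α × α) i => if ε i then w i else (w i).swap)
      (Measure.pi fun _ => D.prod D) (Measure.pi fun _ => D.prod D) := by
    refine measurePreserving_pi (fun _ => D.prod D) (fun _ => D.prod D)
      (f := fun i x => if ε i then x else x.swap) fun i => ?_
    by_cases h : ε i
    · simp only [h, if_true]
      exact MeasurePreserving.id _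
    · simpa [h] using Measure.measurePreserving_swap
  convert (h1.comp h2).comp h1.symm using 1
  ext w i
  · by_cases h : ε i <;>
      simp [h, MeasurableEquiv.arrowProdEquivProdArrow, Equiv.arrowProdEquivProdArrow]
  · by_cases h : ε i <;>
      simp [h, MeasurableEquiv.arrowProdEquivProdArrow, Equiv.arrowProdEquivProdArrow]

/-- Symmetrization for a finite class of functions. -/
theorem integral_sup'_centered_le {α ι : Type*} [MeasurableSpace α] (D : Measure α)
    [IsProbabilityMeasure D] (n : ℕ) {T : Finset ι} (hT : T.Nonempty) {h : ι → α → ℝ}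
    (hint : ∀ t, Integrable (h t) D) :
    2 ^ n * ∫ z, T.sup' hT (fun t => ∑ i, (∫ x, h t x ∂D - h t (z i)))
        ∂(Measure.pi fun _ : Fin n => D) ≤
      2 * ∑ ε : Fin n → Bool, ∫ z, T.sup' hT (fun t => ∑ i, boolSign (ε i) * h t (z i))
        ∂(Measure.pi fun _ : Fin n => D) := by
  set Dn : Measure (Fin n → α) := Measure.pi fun _ => D with hDn
  have hev (t : ι) (i : Fin n) : Integrable (fun z : Fin n → α => h t (z i)) Dn :=
    integrable_comp_eval (hint t)
  have hfst (t : ι) (i : Fin n) :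
      Integrable (fun w : (Fin n → α) × (Fin n → α) => h t (w.1 i)) (Dn.prod Dn) :=
    (hev t i).comp_fst Dn
  have hsnd (t : ι) (i : Fin n) :
      Integrable (fun w : (Fin n → α) × (Fin n → α) => h t (w.2 i)) (Dn.prod Dn) :=
    (hev t i).comp_snd Dn
  set J : (Fin n → Bool) → ℝ := fun ε =>
    ∫ z, T.sup' hT (fun t => ∑ i, boolSign (ε i) * h t (z i)) ∂Dn with hJ
  have hJint (ε : Fin n → Bool) : Integrable
      (fun z : Fin n → α => T.sup' hT (fun t => ∑ i, boolSign (ε i) * h t (z i))) Dn :=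
    integrable_finset_sup' hT fun t _ =>
      integrable_finsetSum _ fun i _ => (hev t i).const_mul _
  have hFint : Integrable (fun w : (Fin n → α) × (Fin n → α) =>
      T.sup' hT (fun t => ∑ i, (h t (w.2 i) - h t (w.1 i)))) (Dn.prod Dn) :=
    integrable_finset_sup' hT fun t _ =>
      integrable_finsetSum _ fun i _ => (hsnd t i).sub (hfst t i)
  -- Ghost sample: each mean is an integral over an independent copy, and a supremum of integrals is
  -- at most the integral of the supremum.
  have ghost : ∫ z, T.sup' hT (fun t => ∑ i, (∫ x, h t x ∂D - h t (z i))) ∂Dn ≤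
      ∫ w, T.sup' hT (fun t => ∑ i, (h t (w.2 i) - h t (w.1 i))) ∂(Dn.prod Dn) := by
    rw [integral_prod _ hFint]
    refine integral_mono (integrable_finset_sup' hT fun t _ =>
      integrable_finsetSum _ fun i _ => (integrable_const _).sub (hev t i))
      hFint.integral_prod_left fun z => ?_
    refine Finset.sup'_le _ _ fun t ht => ?_
    have hsub (t : ι) (i : Fin n) : Integrable (fun z' : Fin n → α => h t (z' i) - h t (z i)) Dn :=
      (hev t i).sub (integrable_const _)
    have e : ∑ i, (∫ x, h t x ∂D - h t (z i)) = ∫ z', ∑ i, (h t (z' i) - h t (z i)) ∂Dn := by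
      rw [integral_finsetSum _ fun i _ => hsub t i]
      refine Finset.sum_congr rfl fun i _ => ?_
      rw [integral_sub (hev t i) (integrable_const _),
        integral_comp_eval (μ := fun _ : Fin n => D) (hint t).aestronglyMeasurable]
      simp
    rw [e]
    refine integral_mono (integrable_finsetSum _ fun i _ => hsub t i)
      (integrable_finset_sup' hT fun t _ =>
        integrable_finsetSum _ fun i _ => hsub t i) fun z' => ?_
    exact T.le_sup' (fun t => ∑ i, (h t (z' i) - h t (z i))) ht
  -- Exchanging coordinates multiplies the `i`-th difference by `boolSign (ε i)`; the supremum then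
  -- splits over the two samples, the second carrying the opposite signs.
  have swap (ε : Fin n → Bool) :
      ∫ w, T.sup' hT (fun t => ∑ i, (h t (w.2 i) - h t (w.1 i))) ∂(Dn.prod Dn) ≤
        J ε + J (fun i => !ε i) := by
    have hmp := measurePreserving_swap_coordinates D ε
    rw [← hDn] at hmp
    have hF2 := hmp.integrable_comp_of_integrable hFint
    have e := integral_map hmp.aemeasurable (f := fun w : (Fin n → α) × (Fin n → α) =>
      T.sup' hT (fun t => ∑ i, (h t (w.2 i) - h t (w.1 i))))
      (by rw [hmp.map_eq]; exact hFint.aestronglyMeasurable)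
    rw [hmp.map_eq] at e
    have i1 := (hJint ε).comp_snd Dn
    have i2 := (hJint (fun i => !ε i)).comp_fst Dn
    have e1 : J ε = ∫ w : (Fin n → α) × (Fin n → α),
        T.sup' hT (fun t => ∑ i, boolSign (ε i) * h t (w.2 i)) ∂(Dn.prod Dn) := by
      rw [integral_fun_snd (μ := Dn) (ν := Dn)
        (fun z => T.sup' hT (fun t => ∑ i, boolSign (ε i) * h t (z i)))]
      simp [hJ]
    have e2 : J (fun i => !ε i) = ∫ w : (Fin n → α) × (Fin n → α),
        T.sup' hT (fun t => ∑ i, boolSign (!ε i) * h t (w.1 i)) ∂(Dn.prod Dn) := by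
      rw [integral_fun_fst (μ := Dn) (ν := Dn)
        (fun z => T.sup' hT (fun t => ∑ i, boolSign (!ε i) * h t (z i)))]
      simp [hJ]
    rw [e, e1, e2, ← integral_add i1 i2]
    refine integral_mono hF2 (i1.add i2) fun w => ?_
    refine Finset.sup'_le _ _ fun t ht => ?_
    refine le_trans (le_of_eq ?_) (add_le_add
      (T.le_sup' (fun t => ∑ i, boolSign (ε i) * h t (w.2 i)) ht)
      (T.le_sup' (fun t => ∑ i, boolSign (!ε i) * h t (w.1 i)) ht))
    rw [← Finset.sum_add_distrib]
    refine Finset.sum_congr rfl fun i _ => ?_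
    cases hi : ε i <;> simp [hi] <;> ring
  have hnot : ∑ ε : Fin n → Bool, J (fun i => !ε i) = ∑ ε, J ε :=
    (Equiv.piCongrRight fun _ => Equiv.boolNot : (Fin n → Bool) ≃ (Fin n → Bool)).sum_comp J
  calc _ ≤ 2 ^ n * ∫ w, T.sup' hT (fun t => ∑ i, (h t (w.2 i) - h t (w.1 i))) ∂(Dn.prod Dn) := by
        gcongr
    _ = ∑ ε : Fin n → Bool,
        ∫ w, T.sup' hT (fun t => ∑ i, (h t (w.2 i) - h t (w.1 i))) ∂(Dn.prod Dn) := by simp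
    _ ≤ ∑ ε : Fin n → Bool, (J ε + J (fun i => !ε i)) := Finset.sum_le_sum fun ε _ => swap ε
    _ = 2 * ∑ ε, J ε := by rw [Finset.sum_add_distrib, hnot]; ring

/-! ### Duality, integrability and continuity in the parameter -/

variable {p : ℕ}

theorem abs_dotProduct_le {v x : Fin p → ℝ} {m : ℝ} (hm : ∀ j, |x j| ≤ m) :
    |v ⬝ᵥ x| ≤ l1Norm v * m := by
  rw [l1Norm, Finset.sum_mul, dotProduct]
  refine (Finset.abs_sum_le_sum_abs _ _).trans (Finset.sum_le_sum fun j _ => ?_)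
  rw [abs_mul]
  exact mul_le_mul_of_nonneg_left (hm j) (abs_nonneg _)

theorem abs_dotProduct_add_abs_dotProduct_le (θ : Param p) {x y : Fin p → ℝ} {m : ℝ}
    (hx : ∀ j, |x j| ≤ m) (hy : ∀ j, |y j| ≤ m) :
    |θ.1 ⬝ᵥ x| + |θ.2 ⬝ᵥ y| ≤ Param.l1Norm θ * m := by
  rw [Param.l1Norm, add_mul]
  exact add_le_add (abs_dotProduct_le hx) (abs_dotProduct_le hy)

theorem abs_obsLoss_sub_le (θ θ' : Param p) (z : Obs p) :
    |obsLoss θ z - obsLoss θ' z| ≤ |(θ - θ').1 ⬝ᵥ z.x| + |(θ - θ').2 ⬝ᵥ z.x| := by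
  rw [Prod.fst_sub, Prod.snd_sub, sub_dotProduct, sub_dotProduct]
  exact abs_loss_sub_loss_le _ _ _ _ _

/-- A crude integrable Lipschitz constant, used for integrability and continuity only; the rate
comes from `abs_obsLoss_sub_le`. -/
theorem abs_obsLoss_sub_le_l1Norm (θ θ' : Param p) (z : Obs p) :
    |obsLoss θ z - obsLoss θ' z| ≤ (∑ j, |z.x j|) * Param.l1Norm (θ - θ') := by
  have h (j : Fin p) : |z.x j| ≤ ∑ j, |z.x j| :=
    Finset.single_le_sum (f := fun j => |z.x j|) (fun _ _ => abs_nonneg _) (Finset.mem_univ j)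
  rw [mul_comm]
  exact (abs_obsLoss_sub_le θ θ' z).trans (abs_dotProduct_add_abs_dotProduct_le _ h h)

theorem continuous_of_abs_sub_le_l1Norm {F : Param p → ℝ} {M : ℝ}
    (h : ∀ θ θ', |F θ - F θ'| ≤ M * Param.l1Norm (θ - θ')) : Continuous F := by
  refine continuous_iff_continuousAt.2 fun θ₀ => ?_
  rw [ContinuousAt, tendsto_iff_dist_tendsto_zero]
  refine squeeze_zero (fun _ => dist_nonneg) (fun θ => h θ θ₀) ?_
  have hc : Continuous fun θ : Param p => M * Param.l1Norm (θ - θ₀) := by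
    unfold Param.l1Norm l1Norm
    fun_prop
  simpa [Param.l1Norm, l1Norm] using hc.tendsto θ₀

theorem measurable_x_apply (j : Fin p) : Measurable fun z : Obs p => z.x j :=
  (measurable_pi_apply j).comp measurable_fst

theorem measurable_obsLoss (θ : Param p) : Measurable (obsLoss θ) := by
  have hdot (v : Fin p → ℝ) : Measurable fun z : Obs p => v ⬝ᵥ z.x := by
    unfold dotProduct
    exact Finset.measurable_sum _ fun j _ => (measurable_x_apply j).const_mul _
  have hs : Measurable fun z : Obs p => ((z.s : ℕ) : ℝ) :=
    (Measurable.of_discrete (f := fun s : Fin 2 => ((s : ℕ) : ℝ))).comp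
      (measurable_snd.comp measurable_snd)
  have h1 := Real.sigmoid_monotone.measurable.comp (hdot θ.1)
  have h2 := Real.sigmoid_monotone.measurable.comp (hdot θ.2)
  exact (hs.neg.mul (h1.mul h2).log).sub
    ((measurable_const.sub hs).mul (measurable_const.sub (h1.mul h2)).log)

theorem integrable_obsLoss (D : Measure (Obs p)) [IsProbabilityMeasure D]
    (hX : ∀ j, Integrable (fun z : Obs p => z.x j) D) (θ : Param p) :
    Integrable (obsLoss θ) D := by
  have hb : Integrable (fun z : Obs p =>
      |loss 0 0 0| + |loss 0 0 1| + (∑ j, |z.x j|) * Param.l1Norm θ) D :=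
    (integrable_const _).add ((integrable_finsetSum _ fun j _ => (hX j).abs).mul_const _)
  refine hb.mono' (measurable_obsLoss θ).aestronglyMeasurable (ae_of_all _ fun z => ?_)
  have h := abs_obsLoss_sub_le_l1Norm θ 0 z
  have h0 : |obsLoss 0 z| ≤ |loss 0 0 0| + |loss 0 0 1| := by
    have e : obsLoss 0 z = loss 0 0 z.s := by simp [obsLoss]
    rw [e]
    obtain hs | hs : z.s = 0 ∨ z.s = 1 := by omega
    · rw [hs]; linarith [abs_nonneg (loss 0 0 1)]
    · rw [hs]; linarith [abs_nonneg (loss 0 0 0)]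
  rw [sub_zero] at h
  rw [Real.norm_eq_abs]
  rw [abs_le] at *
  constructor <;> linarith

/-- The excess loss of `θ` over `θ₀` at an observation. -/
noncomputable def excessLoss (θ₀ θ : Param p) (z : Obs p) : ℝ := obsLoss θ z - obsLoss θ₀ z

/-- The unnormalised centred empirical process of the excess losses. -/
noncomputable def centredProcess {n : ℕ} (D : Measure (Obs p)) (θ₀ θ : Param p)
    (z : Fin n → Obs p) : ℝ :=
  ∑ i, (∫ x, excessLoss θ₀ θ x ∂D - excessLoss θ₀ θ (z i))

theorem abs_excessLoss_sub_le (θ₀ θ θ' : Param p) (z : Obs p) :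
    |excessLoss θ₀ θ z - excessLoss θ₀ θ' z| ≤ (∑ j, |z.x j|) * Param.l1Norm (θ - θ') := by
  simpa [excessLoss] using abs_obsLoss_sub_le_l1Norm θ θ' z

theorem integrable_excessLoss {D : Measure (Obs p)} [IsProbabilityMeasure D]
    (hX : ∀ j, Integrable (fun z : Obs p => z.x j) D) (θ₀ θ : Param p) :
    Integrable (excessLoss θ₀ θ) D :=
  (integrable_obsLoss D hX θ).sub (integrable_obsLoss D hX θ₀)

theorem continuous_centredProcess {n : ℕ} {D : Measure (Obs p)} [IsProbabilityMeasure D]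
    (hX : ∀ j, Integrable (fun z : Obs p => z.x j) D) (θ₀ : Param p) (z : Fin n → Obs p) :
    Continuous fun θ => centredProcess D θ₀ θ z := by
  refine continuous_finsetSum _ fun i _ => Continuous.sub ?_ ?_
  · refine continuous_of_abs_sub_le_l1Norm (M := ∫ z, ∑ j, |z.x j| ∂D) fun θ θ' => ?_
    rw [← integral_sub (integrable_excessLoss hX θ₀ θ) (integrable_excessLoss hX θ₀ θ'),
      ← integral_mul_const]
    refine (abs_integral_le_integral_abs).trans (integral_mono
      ((integrable_excessLoss hX θ₀ θ).sub (integrable_excessLoss hX θ₀ θ')).abs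
      ((integrable_finsetSum _ fun j _ => (hX j).abs).mul_const _)
      fun z => abs_excessLoss_sub_le θ₀ θ θ' z)
  · exact continuous_of_abs_sub_le_l1Norm fun θ θ' => abs_excessLoss_sub_le θ₀ θ θ' (z i)

/-! ### Sub-Gaussian signed sums and the maximal inequality -/

/-- The signed sum of the feature vectors of a sample. -/
def signedSum {n : ℕ} (δ : Fin n → Bool) (z : Fin n → Obs p) (j : Fin p) : ℝ :=
  ∑ i, boolSign (δ i) * (z i).x j

theorem dotProduct_signedSum {n : ℕ} (δ : Fin n → Bool) (z : Fin n → Obs p) (v : Fin p → ℝ) :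
    v ⬝ᵥ signedSum δ z = ∑ i, boolSign (δ i) * (v ⬝ᵥ (z i).x) := by
  simp only [dotProduct, signedSum, Finset.mul_sum]
  rw [Finset.sum_comm]
  exact Finset.sum_congr rfl fun i _ => Finset.sum_congr rfl fun j _ => by ring

/-- The sub-Gaussian bound is invariant under `X ↦ -X`, so the signs may stay fixed and all
randomness comes from the sample. -/
theorem hasSubgaussianMGF_signedSum {n : ℕ} {D : Measure (Obs p)} [IsProbabilityMeasure D]
    {c : ℝ≥0} {j : Fin p} (h : HasSubgaussianMGF (fun z : Obs p => z.x j) c D)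
    (δ : Fin n → Bool) :
    HasSubgaussianMGF (fun z => signedSum δ z j) (n * c) (Measure.pi fun _ : Fin n => D) := by
  have hind : iIndepFun (fun (i : Fin n) (z : Fin n → Obs p) => boolSign (δ i) * (z i).x j)
      (Measure.pi fun _ => D) :=
    iIndepFun_pi (X := fun i (z : Obs p) => boolSign (δ i) * z.x j)
      fun i => ((measurable_x_apply j).const_mul _).aemeasurable
  have hs (i : Fin n) : HasSubgaussianMGF (fun z : Fin n → Obs p => boolSign (δ i) * (z i).x j) c
      (Measure.pi fun _ => D) := by
    have h1 : HasSubgaussianMGF (fun z : Fin n → Obs p => (z i).x j) c (Measure.pi fun _ => D) :=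
      HasSubgaussianMGF.of_map (X := fun z : Obs p => z.x j) (Y := fun z : Fin n → Obs p => z i)
        (measurable_pi_apply i).aemeasurable
        (by rw [(measurePreserving_eval (fun _ : Fin n => D) i).map_eq]; exact h)
    cases δ i
    · simpa [Pi.neg_def] using h1.neg
    · simpa using h1
  simpa [signedSum] using HasSubgaussianMGF.sum_of_iIndepFun hind (s := Finset.univ)
    (c := fun _ => c) fun i _ => hs i

/-- The sum of the exponential moments `exp (±l A_j)` of the coordinates of a signed sum. -/
noncomputable def expSum {n : ℕ} (l : ℝ) (δ : Fin n → Bool) (z : Fin n → Obs p) : ℝ :=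
  ∑ j, (Real.exp (l * signedSum δ z j) + Real.exp (-l * signedSum δ z j))

theorem expSum_nonneg {n : ℕ} (l : ℝ) (δ : Fin n → Bool) (z : Fin n → Obs p) :
    0 ≤ expSum l δ z :=
  Finset.sum_nonneg fun _ _ => by positivity

theorem exp_mul_abs_signedSum_le {n : ℕ} (l : ℝ) (δ : Fin n → Bool) (z : Fin n → Obs p)
    (j : Fin p) : Real.exp (l * |signedSum δ z j|) ≤ expSum l δ z := by
  refine le_trans ?_ (Finset.single_le_sum (f := fun j =>
    Real.exp (l * signedSum δ z j) + Real.exp (-l * signedSum δ z j))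
    (fun _ _ => by positivity) (Finset.mem_univ j))
  rcases abs_cases (signedSum δ z j) with ⟨h, -⟩ | ⟨h, -⟩ <;> rw [h]
  · linarith [Real.exp_pos (-l * signedSum δ z j)]
  · rw [mul_neg, ← neg_mul]
    linarith [Real.exp_pos (l * signedSum δ z j)]

/-- A linearised log-sum-exp bound, with free parameter `K`. -/
theorem le_of_exp_mul_le {l K x E : ℝ} (hl : 0 < l) (hK : 0 < K) (h : Real.exp (l * x) ≤ E) :
    x ≤ (E / K - 1 + Real.log K) / l := by
  -- This is the tangent line of `log` at `K`. The bound is affine in `E`, so it can be integrated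
  -- directly, in place of Jensen's inequality.
  have h1 := Real.add_one_le_exp (l * x - Real.log K)
  rw [Real.exp_sub, Real.exp_log hK] at h1
  have h2 : Real.exp (l * x) / K ≤ E / K := by gcongr
  rw [le_div_iff₀ hl]
  linarith

theorem integrable_expSum {n : ℕ} {D : Measure (Obs p)} [IsProbabilityMeasure D]
    {c : ℝ≥0} (h : ∀ j, HasSubgaussianMGF (fun z : Obs p => z.x j) c D)
    (l : ℝ) (δ : Fin n → Bool) :
    Integrable (expSum (p := p) l δ) (Measure.pi fun _ : Fin n => D) :=
  integrable_finsetSum _ fun j _ =>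
    ((hasSubgaussianMGF_signedSum (h j) δ).integrable_exp_mul l).add
      ((hasSubgaussianMGF_signedSum (h j) δ).integrable_exp_mul (-l))

theorem integral_expSum_le {n : ℕ} {D : Measure (Obs p)} [IsProbabilityMeasure D]
    {c : ℝ≥0} (h : ∀ j, HasSubgaussianMGF (fun z : Obs p => z.x j) c D)
    (l : ℝ) (δ : Fin n → Bool) :
    ∫ z, expSum (p := p) l δ z ∂(Measure.pi fun _ : Fin n => D) ≤
      2 * p * Real.exp (n * c * l ^ 2 / 2) := by
  have hs (j : Fin p) := hasSubgaussianMGF_signedSum (h j) δ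
  have e : ∫ z, expSum (p := p) l δ z ∂(Measure.pi fun _ : Fin n => D) =
      ∑ j, (mgf (fun z => signedSum δ z j) (Measure.pi fun _ : Fin n => D) l +
        mgf (fun z => signedSum δ z j) (Measure.pi fun _ : Fin n => D) (-l)) := by
    unfold expSum
    refine (integral_finsetSum _ fun j _ =>
      ((hs j).integrable_exp_mul l).add ((hs j).integrable_exp_mul (-l))).trans ?_
    exact Finset.sum_congr rfl fun j _ =>
      integral_add ((hs j).integrable_exp_mul l) ((hs j).integrable_exp_mul (-l))
  rw [e]
  calc _ ≤ ∑ _j : Fin p, 2 * Real.exp (n * c * l ^ 2 / 2) := by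
        refine Finset.sum_le_sum fun j _ => ?_
        have h1 := (hs j).mgf_le l
        have h2 := (hs j).mgf_le (-l)
        rw [neg_sq] at h2
        push_cast at h1 h2
        linarith
    _ = _ := by simp; ring

/-- ℓ₁/ℓ∞ duality. Adding both exponential sums gives one bound for the coordinates of both signed
sums, with no independence between them needed. -/
theorem sup'_signed_le {n : ℕ} {θ₀ : Param p} {r l K : ℝ} (hl : 0 < l) (hK : 0 < K)
    (hp : 0 < p) {T : Finset (Param p)} (hT : T.Nonempty)
    (hTr : ∀ θ ∈ T, θ ∈ l1Ball θ₀ r) (z : Fin n → Obs p) (η : Fin n → Bool × Bool) :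
    T.sup' hT (fun θ => 0 + ∑ i, 2 * (boolSign (η i).1 * ((θ - θ₀).1 ⬝ᵥ (z i).x) +
        boolSign (η i).2 * ((θ - θ₀).2 ⬝ᵥ (z i).x))) ≤
      2 * (r * (((expSum l (fun i => (η i).1) z + expSum l (fun i => (η i).2) z) / K - 1 +
        Real.log K) / l)) := by
  set m := ((expSum l (fun i => (η i).1) z + expSum l (fun i => (η i).2) z) / K - 1 +
        Real.log K) / l
  have h1 (j : Fin p) : |signedSum (fun i => (η i).1) z j| ≤ m :=
    le_of_exp_mul_le hl hK ((exp_mul_abs_signedSum_le l _ z j).trans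
      (le_add_of_nonneg_right (expSum_nonneg _ _ _)))
  have h2 (j : Fin p) : |signedSum (fun i => (η i).2) z j| ≤ m :=
    le_of_exp_mul_le hl hK ((exp_mul_abs_signedSum_le l _ z j).trans
      (le_add_of_nonneg_left (expSum_nonneg _ _ _)))
  have hm : 0 ≤ m := (abs_nonneg _).trans (h1 ⟨0, hp⟩)
  refine Finset.sup'_le _ _ fun θ hθ => ?_
  rw [zero_add, ← Finset.mul_sum, Finset.sum_add_distrib]
  have e1 := dotProduct_signedSum (fun i => (η i).1) z (θ - θ₀).1
  have e2 := dotProduct_signedSum (fun i => (η i).2) z (θ - θ₀).2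
  rw [← e1, ← e2]
  have h3 := abs_dotProduct_add_abs_dotProduct_le (θ - θ₀) h1 h2
  have h4 : Param.l1Norm (θ - θ₀) * m ≤ r * m := mul_le_mul_of_nonneg_right (hTr θ hθ) hm
  linarith [le_abs_self ((θ - θ₀).1 ⬝ᵥ signedSum (fun i => (η i).1) z),
    le_abs_self ((θ - θ₀).2 ⬝ᵥ signedSum (fun i => (η i).2) z)]

/-- Maximal inequality for the centred empirical process over a finite subset of the ball, with
free parameter `l`. -/
theorem integral_sup'_centredProcess_le {n : ℕ} {D : Measure (Obs p)} [IsProbabilityMeasure D]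
    {c : ℝ≥0} (h : ∀ j, HasSubgaussianMGF (fun z : Obs p => z.x j) c D) (hp : 0 < p)
    {θ₀ : Param p} {r l : ℝ} (hr : 0 ≤ r) (hl : 0 < l) {T : Finset (Param p)} (hT : T.Nonempty)
    (hTr : ∀ θ ∈ T, θ ∈ l1Ball θ₀ r) :
    ∫ z, T.sup' hT (fun θ => centredProcess D θ₀ θ z) ∂(Measure.pi fun _ : Fin n => D) ≤
      4 * r * (Real.log (4 * p) / l + n * c * l / 2) := by
  have hX (j : Fin p) : Integrable (fun z : Obs p => z.x j) D := (h j).integrable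
  set Dn : Measure (Fin n → Obs p) := Measure.pi fun _ => D with hDn
  have hint (θ : Param p) : Integrable (excessLoss θ₀ θ) D := integrable_excessLoss hX θ₀ θ
  -- `K` bounds the mean of the two exponential sums together, so `E / K - 1` has nonpositive mean
  -- and only `log K / l` survives.
  set K : ℝ := 4 * p * Real.exp (n * c * l ^ 2 / 2) with hKdef
  have hp' : (0 : ℝ) < p := by exact_mod_cast hp
  have hK : 0 < K := by positivity
  set m : (Fin n → Bool × Bool) → (Fin n → Obs p) → ℝ := fun η z =>
    ((expSum l (fun i => (η i).1) z + expSum l (fun i => (η i).2) z) / K - 1 +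
      Real.log K) / l with hmdef
  have hmint (η : Fin n → Bool × Bool) : Integrable (m η) Dn :=
    ((((((integrable_expSum h l _).add (integrable_expSum h l _)).div_const K).sub
      (integrable_const 1)).add (integrable_const _)).div_const l)
  have hm (η : Fin n → Bool × Bool) :
      ∫ z, m η z ∂Dn ≤ Real.log (4 * p) / l + n * c * l / 2 := by
    have i1 := integrable_expSum (n := n) h l (fun i => (η i).1)
    have i2 := integrable_expSum (n := n) h l (fun i => (η i).2)
    have e : ∫ z, m η z ∂Dn = ((∫ z, expSum l (fun i => (η i).1) z ∂Dn +
        ∫ z, expSum l (fun i => (η i).2) z ∂Dn) / K - 1 + Real.log K) / l := by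
      have i3 : Integrable (fun z => (expSum l (fun i => (η i).1) z +
        expSum l (fun i => (η i).2) z) / K) Dn := (i1.add i2).div_const K
      have i4 : Integrable (fun z => (expSum l (fun i => (η i).1) z +
        expSum l (fun i => (η i).2) z) / K - 1) Dn := i3.sub (integrable_const 1)
      simp only [hmdef]
      rw [integral_div, integral_add i4 (integrable_const _), integral_sub i3 (integrable_const 1),
        integral_div, integral_add i1 i2]
      simp [← hDn]
    have b1 := integral_expSum_le (n := n) h l (fun i => (η i).1)
    have b2 := integral_expSum_le (n := n) h l (fun i => (η i).2)
    have b3 : (∫ z, expSum l (fun i => (η i).1) z ∂Dn +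
        ∫ z, expSum l (fun i => (η i).2) z ∂Dn) / K ≤ 1 := by
      rw [div_le_one hK]
      linarith
    have hlogK : Real.log K = Real.log (4 * p) + n * c * l ^ 2 / 2 := by
      rw [hKdef, Real.log_mul (by positivity) (Real.exp_pos _).ne', Real.log_exp]
    rw [e, div_le_iff₀ hl, hlogK, add_mul, div_mul_cancel₀ _ hl.ne']
    linarith
  have sym := integral_sup'_centered_le D n hT hint
  have contr (z : Fin n → Obs p) :
      2 ^ n * ∑ ε : Fin n → Bool, T.sup' hT (fun θ => ∑ i, boolSign (ε i) *
        excessLoss θ₀ θ (z i)) ≤ ∑ η : Fin n → Bool × Bool, 2 * (r * m η z) := by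
    have h1 := sum_sup'_rademacher_le hT n (fun _ => 0) (fun i θ => excessLoss θ₀ θ (z i))
      (fun i θ => (θ - θ₀).1 ⬝ᵥ (z i).x) (fun i θ => (θ - θ₀).2 ⬝ᵥ (z i).x) fun i θ θ' => by
        have := abs_obsLoss_sub_le θ θ' (z i)
        simpa [excessLoss, ← sub_dotProduct] using this
    have h2 := h1.trans (Finset.sum_le_sum fun η _ => sup'_signed_le hl hK hp hT hTr z η)
    simpa only [zero_add] using h2
  have hJint (ε : Fin n → Bool) : Integrable (fun z : Fin n → Obs p =>
      T.sup' hT (fun θ => ∑ i, boolSign (ε i) * excessLoss θ₀ θ (z i))) Dn :=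
    integrable_finset_sup' hT fun θ _ => integrable_finsetSum _ fun i _ =>
      (integrable_comp_eval (hint θ)).const_mul _
  have h2 : 2 ^ n * ∑ ε : Fin n → Bool, ∫ z, T.sup' hT (fun θ => ∑ i, boolSign (ε i) *
        excessLoss θ₀ θ (z i)) ∂Dn ≤
      4 ^ n * (2 * (r * (Real.log (4 * p) / l + n * c * l / 2))) := by
    rw [← integral_finsetSum _ fun ε _ => hJint ε, ← integral_const_mul]
    calc _ ≤ ∫ z, ∑ η : Fin n → Bool × Bool, 2 * (r * m η z) ∂Dn :=
          integral_mono ((integrable_finsetSum _ fun ε _ => hJint ε).const_mul _)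
            (integrable_finsetSum _ fun η _ => ((hmint η).const_mul r).const_mul 2) contr
      _ = ∑ η : Fin n → Bool × Bool, 2 * (r * ∫ z, m η z ∂Dn) := by
          rw [integral_finsetSum _ fun η _ => ((hmint η).const_mul r).const_mul 2]
          simp only [integral_const_mul]
      _ ≤ ∑ _η : Fin n → Bool × Bool,
          2 * (r * (Real.log (4 * p) / l + n * c * l / 2)) := by
          gcongr with η
          exact hm η
      _ = _ := by simp
  have h4 : (4 : ℝ) ^ n = 2 ^ n * 2 ^ n := by rw [← mul_pow]; norm_num
  rw [h4, mul_assoc] at h2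
  have h3 := le_of_mul_le_mul_left h2 (by positivity)
  refine le_of_mul_le_mul_left (sym.trans ?_) (show (0 : ℝ) < 2 ^ n by positivity)
  linarith

/-! ### Tail bound over the ball -/

/-- For `p ≥ 2`, `4p ≤ p³`, so `log (4p) ≤ 3 log p`. After this the optimal `l` is `√6 √(log p / n)
/ μ`; replacing `√6` by 2 costs little and gives `3/2 + 1 = 5/2`. -/
theorem log_four_mul_div_add_le {p n : ℕ} (hp : 2 ≤ p) (hn : 0 < n) {μ : ℝ≥0} (hμ : 0 < μ) :
    Real.log (4 * p) / (2 * Real.sqrt (Real.log p / n) / μ) +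
      n * (μ ^ 2 : ℝ≥0) * (2 * Real.sqrt (Real.log p / n) / μ) / 2 ≤
    5 / 2 * μ * n * Real.sqrt (Real.log p / n) := by
  have hp' : (2 : ℝ) ≤ p := by exact_mod_cast hp
  have hn' : (0 : ℝ) < n := by exact_mod_cast hn
  have hμ' : (0 : ℝ) < μ := by exact_mod_cast hμ
  have hlog : 0 < Real.log p := Real.log_pos (by linarith)
  set q := Real.sqrt (Real.log p / n) with hq
  have hq0 : 0 < q := Real.sqrt_pos.2 (by positivity)
  have hqq : Real.log p = n * q ^ 2 := by
    rw [hq, Real.sq_sqrt (by positivity)]; field_simp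
  have h4 : Real.log (4 * p) ≤ 3 * Real.log p := by
    have e : 3 * Real.log p = Real.log ((p : ℝ) ^ 3) := by
      rw [Real.log_pow]; norm_num
    rw [e]
    refine Real.log_le_log (by positivity) ?_
    nlinarith [mul_nonneg (by linarith : (0 : ℝ) ≤ p) (by nlinarith : (0 : ℝ) ≤ (p : ℝ) ^ 2 - 4)]
  have h5 : Real.log (4 * p) / (2 * q / μ) ≤ 3 / 2 * μ * n * q := by
    rw [div_le_iff₀ (by positivity)]
    refine (h4.trans_eq ?_)
    rw [hqq]
    field_simp
  have h6 : (n : ℝ) * (μ ^ 2 : ℝ≥0) * (2 * q / μ) / 2 = μ * n * q := by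
    push_cast
    field_simp
  linarith

theorem measure_exists_centredProcess_gt_finset_le {n : ℕ} {D : Measure (Obs p)}
    [IsProbabilityMeasure D] {μ : ℝ≥0} (hμ : 0 < μ)
    (h : ∀ j, HasSubgaussianMGF (fun z : Obs p => z.x j) (μ ^ 2) D) (hp : 2 ≤ p) (hn : 0 < n)
    {θ₀ : Param p} {r s : ℝ} (hr : 0 < r) (hs : 0 < s) {T : Finset (Param p)}
    (h0 : θ₀ ∈ T) (hTr : ∀ θ ∈ T, θ ∈ l1Ball θ₀ r) :
    (Measure.pi fun _ : Fin n => D) {z | ∃ θ ∈ T,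
        n * (32 * μ * r / s * Real.sqrt (Real.log p / n)) < centredProcess D θ₀ θ z} ≤
      ENNReal.ofReal s := by
  have hp' : (2 : ℝ) ≤ p := by exact_mod_cast hp
  have hn' : (0 : ℝ) < n := by exact_mod_cast hn
  have hμ' : (0 : ℝ) < μ := by exact_mod_cast hμ
  have hlog : 0 < Real.log p := Real.log_pos (by linarith)
  have hT : T.Nonempty := ⟨θ₀, h0⟩
  have hX (j : Fin p) : Integrable (fun z : Obs p => z.x j) D := (h j).integrable
  have hbound := log_four_mul_div_add_le hp hn hμ
  set q := Real.sqrt (Real.log p / n) with hq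
  have hq0 : 0 < q := Real.sqrt_pos.2 (by positivity)
  have hE := (integral_sup'_centredProcess_le (n := n) h (by omega) hr.le
    (l := 2 * q / μ) (by positivity) hT hTr).trans
    (mul_le_mul_of_nonneg_left hbound (by positivity))
  set S : (Fin n → Obs p) → ℝ := fun z => T.sup' hT (fun θ => centredProcess D θ₀ θ z) with hS
  -- The process vanishes at `θ₀ ∈ T`, which supplies the nonnegativity that Markov's inequality
  -- requires.
  have hSnn (z : Fin n → Obs p) : 0 ≤ S z := by
    refine le_trans (le_of_eq ?_) (T.le_sup' (fun θ => centredProcess D θ₀ θ z) h0)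
    simp [centredProcess, excessLoss]
  have hSint : Integrable S (Measure.pi fun _ : Fin n => D) :=
    integrable_finset_sup' hT fun θ _ => integrable_finsetSum _ fun i _ =>
      (integrable_const _).sub (integrable_comp_eval (integrable_excessLoss hX θ₀ θ))
  have hM := mul_meas_ge_le_integral_of_nonneg (ae_of_all _ hSnn) hSint
    (n * (32 * μ * r / s * q))
  have hsub : {z : Fin n → Obs p | ∃ θ ∈ T, n * (32 * μ * r / s * q) < centredProcess D θ₀ θ z} ⊆
      {z | n * (32 * μ * r / s * q) ≤ S z} := by
    rintro z ⟨θ, hθ, hz⟩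
    exact hz.le.trans (T.le_sup' (fun θ => centredProcess D θ₀ θ z) hθ)
  refine (measure_mono hsub).trans ?_
  rw [← ofReal_measureReal]
  refine ENNReal.ofReal_le_ofReal ?_
  have h5 := hM.trans hE
  have e : (n : ℝ) * (32 * μ * r / s * q) = n * μ * r * q * 32 / s := by ring
  rw [e] at h5 ⊢
  generalize (Measure.pi fun _ : Fin n => D).real {z | n * μ * r * q * 32 / s ≤ S z} = y at *
  have hc : 0 < n * μ * r * q := by positivity
  have h6 : (n * μ * r * q) * (32 * y) ≤ (n * μ * r * q) * (10 * s) := by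
    have : n * μ * r * q * 32 / s * y * s ≤ 4 * r * (5 / 2 * μ * n * q) * s := by gcongr
    rw [div_mul_eq_mul_div, div_mul_cancel₀ _ hs.ne'] at this
    linarith
  have := le_of_mul_le_mul_left h6 hc
  linarith

theorem measure_exists_centredProcess_gt_le {n : ℕ} {D : Measure (Obs p)}
    [IsProbabilityMeasure D] {μ : ℝ≥0} (hμ : 0 < μ)
    (h : ∀ j, HasSubgaussianMGF (fun z : Obs p => z.x j) (μ ^ 2) D) (hp : 2 ≤ p) (hn : 0 < n)
    {θ₀ : Param p} {r s : ℝ} (hr : 0 < r) (hs : 0 < s) :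
    (Measure.pi fun _ : Fin n => D) {z | ∃ θ ∈ l1Ball θ₀ r,
        n * (32 * μ * r / s * Real.sqrt (Real.log p / n)) < centredProcess D θ₀ θ z} ≤
      ENNReal.ofReal s := by
  classical
  have hX (j : Fin p) : Integrable (fun z : Obs p => z.x j) D := (h j).integrable
  set c := n * (32 * μ * r / s * Real.sqrt (Real.log p / n)) with hc
  have h0 : θ₀ ∈ l1Ball θ₀ r := by simpa [l1Ball, Param.l1Norm, l1Norm] using hr.le
  have : Nonempty (l1Ball θ₀ r) := ⟨⟨θ₀, h0⟩⟩
  set u : ℕ → l1Ball θ₀ r := TopologicalSpace.denseSeq (l1Ball θ₀ r)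
  set T : ℕ → Finset (Param p) := fun N =>
    insert θ₀ ((Finset.range N).image fun k => (u k : Param p)) with hT
  have hsub : {z : Fin n → Obs p | ∃ θ ∈ l1Ball θ₀ r, c < centredProcess D θ₀ θ z} ⊆
      ⋃ N, {z | ∃ θ ∈ T N, c < centredProcess D θ₀ θ z} := by
    rintro z ⟨θ, hθ, hz⟩
    -- The strict inequality makes the exceedance set open, so it meets the dense sequence.
    have hopen : IsOpen {θ : l1Ball θ₀ r | c < centredProcess D θ₀ θ z} :=
      isOpen_lt continuous_const
        ((continuous_centredProcess hX θ₀ z).comp continuous_subtype_val)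
    obtain ⟨_, hk, k, rfl⟩ := (TopologicalSpace.denseRange_denseSeq (l1Ball θ₀ r)).inter_open_nonempty
      _ hopen ⟨⟨θ, hθ⟩, hz⟩
    exact Set.mem_iUnion.2 ⟨k + 1, u k, by
      simp only [hT, Finset.mem_insert, Finset.mem_image, Finset.mem_range]
      exact Or.inr ⟨k, Nat.lt_succ_self k, rfl⟩, hk⟩
  have hmono : Monotone fun N => {z : Fin n → Obs p | ∃ θ ∈ T N, c < centredProcess D θ₀ θ z} := by
    rintro N N' hN z ⟨θ, hθ, hz⟩
    refine ⟨θ, ?_, hz⟩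
    exact Finset.insert_subset_insert _
      (Finset.image_subset_image (Finset.range_subset_range.2 hN)) hθ
  refine (measure_mono hsub).trans ?_
  -- Continuity from below along an increasing union needs no measurability of the sets.
  rw [hmono.measure_iUnion]
  refine iSup_le fun N => measure_exists_centredProcess_gt_finset_le hμ h hp hn hr hs
    (Finset.mem_insert_self _ _) fun θ hθ => ?_
  simp only [hT, Finset.mem_insert, Finset.mem_image] at hθ
  obtain rfl | ⟨k, -, rfl⟩ := hθ
  · exact h0
  · exact (u k).2

/-! ### Basic inequality and conclusion -/

/-- The centred process is `n` times the excess risk minus `n` times the empirical excess risk, and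
the latter is nonpositive at a minimiser. -/
theorem mul_excessRisk_le_centredProcess {n : ℕ} (hn : 0 < n) {D : Measure (Obs p)}
    [IsProbabilityMeasure D] (hX : ∀ j, Integrable (fun z : Obs p => z.x j) D)
    {θ₀ θ : Param p} {r : ℝ} (hr : 0 ≤ r) {z : Fin n → Obs p} (hθ : IsBallMinimiser z θ₀ r θ) :
    n * excessRisk D θ₀ θ ≤ centredProcess D θ₀ θ z := by
  have h0 : θ₀ ∈ l1Ball θ₀ r := by simpa [l1Ball, Param.l1Norm, l1Norm] using hr
  have hn' : (0 : ℝ) < n := by exact_mod_cast hn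
  have h1 : empRisk z θ ≤ empRisk z θ₀ := hθ.2 h0
  unfold empRisk at h1
  have h2 := le_of_mul_le_mul_left h1 (by positivity)
  have e : ∫ x, excessLoss θ₀ θ x ∂D = excessRisk D θ₀ θ :=
    integral_sub (integrable_obsLoss D hX θ) (integrable_obsLoss D hX θ₀)
  simp only [centredProcess, e]
  simp only [excessLoss, Finset.sum_sub_distrib, Finset.sum_const,
    Finset.card_univ, Fintype.card_fin, nsmul_eq_mul]
  linarith

end PULearning

/-- Excess risk bound in the double logistic model. The estimator is not required to be measurable:
the last conjunct bounds the outer probability of the exceptional event. -/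
theorem theorem1 {p n : ℕ} (hp : 2 ≤ p) (hn : 0 < n)
    -- the joint law of `(X, Y, S)` and the double logistic model
    (D : Measure (PULearning.Obs p)) [IsProbabilityMeasure D]
    (β γ : Fin p → ℝ) (hD : PULearning.IsDoubleLogistic D β γ)
    -- an iid sample `(X_i, Y_i, S_i)` from `D`
    {Ω : Type*} [MeasurableSpace Ω] (P : Measure Ω) [IsProbabilityMeasure P]
    (Z : Fin n → Ω → PULearning.Obs p)
    (hlaw : ∀ i, HasLaw (Z i) D P) (hindep : iIndepFun Z P)
    -- sub-Gaussian predictors: `E exp(t X_ij) ≤ exp(μ² t² / 2)`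
    (μ : ℝ≥0) (hμ : 0 < μ)
    (hsub : ∀ i j, HasSubgaussianMGF (fun ω => (Z i ω).x j) (μ ^ 2) P)
    -- any minimiser of the empirical risk over the ball
    (r : ℝ) (hr : 0 < r)
    (θhat : Ω → PULearning.Param p)
    (hθ : ∀ᵐ ω ∂P, PULearning.IsBallMinimiser (fun i => Z i ω) (β, γ) r (θhat ω))
    (s : ℝ) (hs0 : 0 < s) (hs1 : s < 1) :
    (∀ θ : PULearning.Param p, Integrable (PULearning.obsLoss θ) D) ∧
    1 - s ≤ P.real {ω | PULearning.excessRisk D (β, γ) (θhat ω)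
        ≤ 32 * (μ : ℝ) * r / s * Real.sqrt (Real.log p / n)} ∧
    P.real {ω | 32 * (μ : ℝ) * r / s * Real.sqrt (Real.log p / n)
        < PULearning.excessRisk D (β, γ) (θhat ω)} ≤ s := by
  have hmap : ∀ i, P.map (Z i) = D := fun i => (hlaw i).map_eq
  have hae : ∀ i, AEMeasurable (Z i) P := fun i => (hlaw i).aemeasurable
  have hD' : ∀ j, HasSubgaussianMGF (fun z : PULearning.Obs p => z.x j) (μ ^ 2) D := fun j => by
    refine (hsub ⟨0, hn⟩ j).congr_identDistrib ?_
    have hx := PULearning.measurable_x_apply j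
    refine ⟨(hx.comp_aemeasurable (hae _)), hx.aemeasurable, ?_⟩
    rw [← hmap ⟨0, hn⟩, AEMeasurable.map_map_of_aemeasurable hx.aemeasurable (hae _)]
    rfl
  have hX (j : Fin p) : Integrable (fun z : PULearning.Obs p => z.x j) D := (hD' j).integrable
  have hpi : P.map (fun ω i => Z i ω) = Measure.pi fun _ => D := by
    rw [(iIndepFun_iff_map_fun_eq_pi_map hae).1 hindep]
    simp only [hmap]
  set c := 32 * (μ : ℝ) * r / s * Real.sqrt (Real.log p / n) with hc
  have hn' : (0 : ℝ) < n := by exact_mod_cast hn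
  have hbad : P {ω | c < PULearning.excessRisk D (β, γ) (θhat ω)} ≤ ENNReal.ofReal s := by
    calc _ ≤ P ((fun ω i => Z i ω) ⁻¹' {z | ∃ θ ∈ PULearning.l1Ball (β, γ) r,
          n * c < PULearning.centredProcess D (β, γ) θ z}) := by
          refine measure_mono_ae ?_
          filter_upwards [hθ] with ω hω hlt
          exact ⟨θhat ω, hω.1, (mul_lt_mul_of_pos_left hlt hn').trans_le
            (PULearning.mul_excessRisk_le_centredProcess hn hX hr.le hω)⟩
      -- This inequality holds for arbitrary sets, so the exceptional event may be non-measurable.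
      _ ≤ P.map (fun ω i => Z i ω) _ := Measure.le_map_apply (aemeasurable_pi_lambda _ hae) _
      _ ≤ ENNReal.ofReal s := by
          rw [hpi]
          exact PULearning.measure_exists_centredProcess_gt_le hμ hD' hp hn hr hs0
  have hbad' : P.real {ω | c < PULearning.excessRisk D (β, γ) (θhat ω)} ≤ s :=
    ENNReal.toReal_le_of_le_ofReal hs0.le hbad
  refine ⟨PULearning.integrable_obsLoss D hX, ?_, hbad'⟩
  -- Subadditivity replaces the complement rule, which would need measurability.
  have hunion : {ω | PULearning.excessRisk D (β, γ) (θhat ω) ≤ c} ∪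
      {ω | c < PULearning.excessRisk D (β, γ) (θhat ω)} = Set.univ := by
    ext ω
    simpa using le_or_gt _ _
  have h1 := measureReal_union_le (μ := P) {ω | PULearning.excessRisk D (β, γ) (θhat ω) ≤ c}
    {ω | c < PULearning.excessRisk D (β, γ) (θhat ω)}
  rw [hunion, probReal_univ] at h1
  linarith
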